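/- A \emph{non-autonomous iterated function system} (NAIFS) $(X,\Phi)$ is a set $X$ with a sequence $(\Phi^{(j)})_{j\ge 1}$ of collections $\Phi^{(j)}=\{\varphi^{(j)}_i:X\to X\}_{i\in I^{(j)}}$ of maps, where each $I^{(j)}$ is a non-empty finite set. For $m,n\ge 1$, a word $w=w_m w_{m+1}\cdots w_{m+n-1}\in I^{m,n}:=\prod_{j=0}^{n-1}I^{(m+j)}$ and $0\le k\le n$ put $\varphi_w^{m,k}:=\varphi^{(m+k-1)}_{w_{m+k-1}}\circ\cdots\circ\varphi^{(m)}_{w_m}$ (so $\varphi_w^{m,0}=\mathrm{id}$), and, if $d$ is a metric on $X$, $d_{w,n}(x,y):=\max_{0\le k\le n} d(\varphi_w^{m,k}(x),\varphi_w^{m,k}(y))$. For $\delta>0$, the NAIFS is \emph{$\delta$-expansive} if for every $\gamma>0$ there is $k_0\ge 1$ such that $d_{w,n}(x,y)>\delta$ for all $x,y\in X$ with $d(x,y)\ge\gamma$, all $m\ge 1$, all $n\ge k_0$ and all $w\in I^{m,n}$; it is \emph{$\ast$-expansive} if it is $\delta$-expansive for some $\delta>0$. Let $M$ be a compact (boundaryless,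 smooth) Riemannian manifold with its Riemannian distance $d$ (equal to $\infty$ between different connected components), and let $B(p,r)$ denote the open ball. A $C^1$ local diffeomorphism $f:M\to M$ is \emph{expanding} if there are $\tau>1$ and some smooth Riemannian metric on $M$ for which $\|Df(x)v\|\ge\tau\|v\|$ for all $x\in M$ and $v\in T_xM$. For $\sigma>1$ and $\rho>0$, such an $f$ has \emph{expansion factor} $\sigma$ and \emph{injectivity constant} $\rho$ if (i) for every $p\in M$, $f(B(p,\rho))$ contains a neighbourhood of the closure of $B(f(p),\rho)$; (ii) $d(f(x),f(y))\ge\sigma\, d(x,y)$ for every $p\in M$ and all $x,y\in B(p,\rho)$; (iii) for all $x,y\in M$ with $f(x)=y$ there is a $C^1$ map $h:B(y,\rho)\to M$ with $f\circ h=\mathrm{id}$, $h(y)=x$ and $d(h(y_1),h(y_2))\le\sigma^{-1}d(y_1,y_2)$ for all $y_1,y_2\in B(y,\rho)$. An NAIFS $(M,\Phi)$ is \emph{uniformly expanding} with uniform expansion factor $\sigma>1$ and injectivity constant $\rho>0$ if every map $\varphi^{(j)}_i$, $j\ge 1$, $i\in I^{(j)}$, is an expanding $C^1$ local diffeomorphism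 with expansion factor $\sigma$ and injectivity constant $\rho$. \textbf{Proposition.} Let $(M,\Phi)$ be a uniformly expanding NAIFS on a compact Riemannian manifold $M$, with uniform expansion factor $\sigma>1$ and injectivity constant $\rho>0$. Then $(M,\Phi)$ is $\ast$-expansive; in fact, it is $\rho$-expansive. -/

import Mathlib

open scoped Manifold ContDiff Topology ENNReal Bundle

noncomputable section

/-- A non-autonomous iterated function system on a set `X`: a sequence of non-empty finite
collections of self-maps of `X`. The sequence is indexed from `0`, so that `Index j` and `map j`
stand for `I^{(j+1)}` and `φ^{(j+1)}`. -/
structure NAIFS (X : Type*) where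
  Index : ℕ → Type
  finite_index : ∀ j, Finite (Index j)
  nonempty_index : ∀ j, Nonempty (Index j)
  map : ∀ j, Index j → X → X

namespace NAIFS

/-- Words of length `n` that start at time `m`: one index for each of the times
`m, m + 1, …, m + n - 1`. -/
def Word {X : Type*} (Φ : NAIFS X) (m n : ℕ) : Type :=
  (j : Fin n) → Φ.Index (m + j)

/-- The composition of the maps given by the first `k` letters of the word `w`, the first letter
being applied first; the identity for `k = 0`. -/
def comp {X : Type*} (Φ : NAIFS X) {m n : ℕ} (w : Φ.Word m n) : (k : ℕ) → k ≤ n → X → X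
  | 0, _ => id
  | k + 1, h => Φ.map (m + k) (w ⟨k, h⟩) ∘ Φ.comp w k (Nat.le_of_succ_le h)

/-- The Bowen metric of a word `w` of length `n`: the largest distance between the first `n + 1`
points of the `w`-orbits of `x` and `y`. Distances may be infinite. -/
def bowenEDist {X : Type*} [EMetricSpace X] (Φ : NAIFS X) {m n : ℕ} (w : Φ.Word m n)
    (x y : X) : ℝ≥0∞ :=
  ⨆ k : Fin (n + 1),
    edist (Φ.comp w k (Nat.le_of_lt_succ k.isLt) x) (Φ.comp w k (Nat.le_of_lt_succ k.isLt) y)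

/-- `δ`-expansivity; the threshold `k₀` depends on `γ` only. -/
def IsExpansive {X : Type*} [EMetricSpace X] (Φ : NAIFS X) (δ : ℝ) : Prop :=
  ∀ γ : ℝ, 0 < γ → ∃ k₀ : ℕ, 1 ≤ k₀ ∧
    ∀ x y : X, ENNReal.ofReal γ ≤ edist x y →
      ∀ m n : ℕ, k₀ ≤ n → ∀ w : Φ.Word m n, ENNReal.ofReal δ < Φ.bowenEDist w x y

/-- `∗`-expansivity: `δ`-expansivity for some `δ > 0`. -/
def IsStarExpansive {X : Type*} [EMetricSpace X] (Φ : NAIFS X) : Prop :=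
  ∃ δ : ℝ, 0 < δ ∧ Φ.IsExpansive δ

end NAIFS

/-- `f` is an expanding `C¹` local diffeomorphism: for some Riemannian metric `g` on `M` and some
`τ > 1`, one has `‖Df(x) v‖ ≥ τ ‖v‖` for all tangent vectors, the norms being those of `g`. -/
def IsExpandingLocalDiffeo {E : Type*} [NormedAddCommGroup E] [NormedSpace ℝ E]
    {H : Type*} [TopologicalSpace H] (I : ModelWithCorners ℝ E H)
    {M : Type*} [TopologicalSpace M] [ChartedSpace H M] [IsManifold I ∞ M]
    (f : M → M) : Prop :=
  IsLocalDiffeomorph I I 1 f ∧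
    ∃ (τ : ℝ) (g : Bundle.ContMDiffRiemannianMetric I ∞ E (fun x : M ↦ TangentSpace I x)),
      1 < τ ∧ ∀ (x : M) (v : TangentSpace I x),
        τ * √(g.inner x v v) ≤
          √(g.inner (f x) (mfderiv I I f x v) (mfderiv I I f x v))

/-- The class `𝓔(σ, ρ)` of expanding `C¹` local diffeomorphisms of `M` with expansion factor `σ`
and injectivity constant `ρ`, with respect to the distance of `M`. -/
structure IsExpandingWith {E : Type*} [NormedAddCommGroup E] [NormedSpace ℝ E]
    {H : Type*} [TopologicalSpace H] (I : ModelWithCorners ℝ E H)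
    {M : Type*} [EMetricSpace M] [ChartedSpace H M] [IsManifold I ∞ M]
    (σ ρ : ℝ) (f : M → M) : Prop where
  expanding : IsExpandingLocalDiffeo I f
  /-- The image of `B(p, ρ)` contains a neighbourhood of the closure of `B(f p, ρ)`. -/
  image_ball : ∀ p : M,
    f '' Metric.eball p (ENNReal.ofReal ρ) ∈ 𝓝ˢ (closure (Metric.eball (f p) (ENNReal.ofReal ρ)))
  /-- `f` expands distances on balls of radius `ρ`. -/
  le_edist : ∀ p : M, ∀ x ∈ Metric.eball p (ENNReal.ofReal ρ),
    ∀ y ∈ Metric.eball p (ENNReal.ofReal ρ),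
      ENNReal.ofReal σ * edist x y ≤ edist (f x) (f y)
  /-- Through each preimage `x` of `y` there is a `C¹` inverse branch `h` on `B(y, ρ)`, which
  contracts distances. Values of `h` outside the ball are irrelevant. -/
  inverse_branch : ∀ x y : M, f x = y → ∃ h : M → M,
    ContMDiffOn I I 1 h (Metric.eball y (ENNReal.ofReal ρ)) ∧
    (∀ z ∈ Metric.eball y (ENNReal.ofReal ρ), f (h z) = z) ∧
    h y = x ∧
    ∀ y₁ ∈ Metric.eball y (ENNReal.ofReal ρ), ∀ y₂ ∈ Metric.eball y (ENNReal.ofReal ρ),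
      edist (h y₁) (h y₂) ≤ ENNReal.ofReal σ⁻¹ * edist y₁ y₂

/-- `Φ` is a uniformly expanding NAIFS with uniform expansion factor `σ > 1` and injectivity
constant `ρ > 0`. -/
def NAIFS.IsUniformlyExpanding {E : Type*} [NormedAddCommGroup E] [NormedSpace ℝ E]
    {H : Type*} [TopologicalSpace H] (I : ModelWithCorners ℝ E H)
    {M : Type*} [EMetricSpace M] [ChartedSpace H M] [IsManifold I ∞ M]
    (Φ : NAIFS M) (σ ρ : ℝ) : Prop :=
  1 < σ ∧ 0 < ρ ∧ ∀ (j : ℕ) (i : Φ.Index j), IsExpandingWith I σ ρ (Φ.map j i)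

end

/-! If two orbits along a word of length `n` stay within `ρ`, each step expands their distance by
`σ`, so `σ ^ n * γ ≤ ρ`; this fails once `n` is large in terms of `σ`, `ρ`, `γ` alone
(`NAIFS.pow_mul_edist_le`, `NAIFS.isExpansive_of_mul_edist_le`). The delicate point is distance
exactly `ρ`: expansion is assumed only inside open `ρ`-balls, while negating `> ρ` gives `≤ ρ`.
There neither point can serve as centre, but one on a nearly shortest path between them can
(`exists_mem_eball_of_edist_le`). -/

/-- In a Riemannian manifold, two points at distance at most `r` lie in a common open ball of
radius `r`. -/
theorem exists_mem_eball_of_edist_le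
    {E : Type*} [NormedAddCommGroup E] [NormedSpace ℝ E]
    {H : Type*} [TopologicalSpace H] (I : ModelWithCorners ℝ E H)
    {M : Type*} [EMetricSpace M] [ChartedSpace H M]
    [Bundle.RiemannianBundle (fun x : M ↦ TangentSpace I x)]
    [IsRiemannianManifold I M]
    {r : ℝ≥0∞} (hr : 0 < r) (hr' : r ≠ ⊤) {x y : M} (hxy : edist x y ≤ r) :
    ∃ p : M, x ∈ Metric.eball p r ∧ y ∈ Metric.eball p r := by
  have half_pos : 0 < r / 2 := ENNReal.half_pos hr.ne'
  have half_lt : r / 2 < r := ENNReal.half_lt_self hr.ne' hr'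
  rcases hxy.lt_or_eq with hlt | heq
  · exact ⟨x, by simpa using hr, by simpa [edist_comm] using hlt⟩
  -- The slack `r / 2` is chosen so that cutting off an initial piece of length at least `r / 2`
  -- leaves a piece shorter than `r`.
  have hlen : Manifold.riemannianEDist I x y < r + r / 2 := by
    rw [← IsRiemannianManifold.out (I := I) x y, heq]
    exact ENNReal.lt_add_right hr' half_pos.ne'
  obtain ⟨c, hc0, hc1, hc, hcr⟩ := Manifold.exists_lt_of_riemannianEDist_lt hlen
  have hcont : ContinuousOn (fun t ↦ edist x (c t)) (Set.Icc 0 1) :=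
    continuous_edist.comp_continuousOn (continuousOn_const.prodMk hc.continuousOn)
  obtain ⟨t, ht, htr⟩ : ∃ t ∈ Set.Icc (0 : ℝ) 1, edist x (c t) = r / 2 := by
    apply intermediate_value_Icc zero_le_one hcont
    simp [hc0, hc1, heq, half_lt.le]
  refine ⟨c t, by simpa [htr] using half_lt, ?_⟩
  have hleft : edist x (c t) ≤ Manifold.pathELength I c 0 t := by
    rw [IsRiemannianManifold.out (I := I)]
    exact Manifold.riemannianEDist_le_pathELength
      (hc.mono (Set.Icc_subset_Icc_right ht.2)) hc0 rfl ht.1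
  have hright : edist (c t) y ≤ Manifold.pathELength I c t 1 := by
    rw [IsRiemannianManifold.out (I := I)]
    exact Manifold.riemannianEDist_le_pathELength
      (hc.mono (Set.Icc_subset_Icc_left ht.1)) rfl hc1 ht.2
  have hsum : r / 2 + edist (c t) y < r / 2 + r :=
    calc r / 2 + edist (c t) y
        ≤ Manifold.pathELength I c 0 t + Manifold.pathELength I c t 1 :=
          add_le_add (htr ▸ hleft) hright
      _ = Manifold.pathELength I c 0 1 := Manifold.pathELength_add ht.1 ht.2
      _ < r / 2 + r := by rwa [add_comm (r / 2)]
  rw [Metric.mem_eball, edist_comm]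
  exact lt_of_add_lt_add_left hsum

/-- If every map of the system expands by `s` the distances that are at most `r`, then the
distance of two orbits that stay `r`-close grows at least like `s ^ k`. -/
theorem NAIFS.pow_mul_edist_le {X : Type*} [EMetricSpace X] (Φ : NAIFS X) {s r : ℝ≥0∞}
    (hΦ : ∀ (j : ℕ) (i : Φ.Index j) (x y : X), edist x y ≤ r →
      s * edist x y ≤ edist (Φ.map j i x) (Φ.map j i y))
    {m n : ℕ} (w : Φ.Word m n) {x y : X} (hxy : Φ.bowenEDist w x y ≤ r) :
    ∀ (k : ℕ) (hk : k ≤ n), s ^ k * edist x y ≤ edist (Φ.comp w k hk x) (Φ.comp w k hk y)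
  | 0, _ => by simp [NAIFS.comp]
  | k + 1, hk => by
    have hle := Nat.le_of_succ_le hk
    have hclose : edist (Φ.comp w k hle x) (Φ.comp w k hle y) ≤ r :=
      (le_iSup (fun k : Fin (n + 1) ↦ edist (Φ.comp w k (Nat.le_of_lt_succ k.isLt) x)
        (Φ.comp w k (Nat.le_of_lt_succ k.isLt) y)) ⟨k, Nat.lt_succ_of_le hle⟩).trans hxy
    calc s ^ (k + 1) * edist x y = s * (s ^ k * edist x y) := by ring
      _ ≤ s * edist (Φ.comp w k hle x) (Φ.comp w k hle y) := by
        gcongr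
        exact Φ.pow_mul_edist_le hΦ w hxy k hle
      _ ≤ _ := hΦ _ _ _ _ hclose

/-- A system whose maps all expand by `σ > 1` the distances that are at most `ρ` is
`ρ`-expansive. -/
theorem NAIFS.isExpansive_of_mul_edist_le {X : Type*} [EMetricSpace X] (Φ : NAIFS X) {σ ρ : ℝ}
    (hσ : 1 < σ)
    (hΦ : ∀ (j : ℕ) (i : Φ.Index j) (x y : X), edist x y ≤ ENNReal.ofReal ρ →
      ENNReal.ofReal σ * edist x y ≤ edist (Φ.map j i x) (Φ.map j i y)) :
    Φ.IsExpansive ρ := by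
  intro γ hγ
  obtain ⟨N, hN⟩ := pow_unbounded_of_one_lt (ρ / γ) hσ
  -- `N` already gives enough growth; the `+ 1` only secures `1 ≤ k₀`.
  refine ⟨N + 1, Nat.le_add_left 1 N, fun x y hxy m n hn w ↦ ?_⟩
  by_contra! hle
  have hgrow : ρ < σ ^ n * γ := by
    rw [div_lt_iff₀ hγ] at hN
    have : σ ^ N ≤ σ ^ n := pow_le_pow_right₀ hσ.le (by lia)
    exact hN.trans_le (by gcongr)
  have hbound : ENNReal.ofReal (σ ^ n * γ) ≤ ENNReal.ofReal ρ :=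
    calc ENNReal.ofReal (σ ^ n * γ) = ENNReal.ofReal σ ^ n * ENNReal.ofReal γ := by
          rw [ENNReal.ofReal_mul (by positivity), ENNReal.ofReal_pow (by positivity)]
      _ ≤ ENNReal.ofReal σ ^ n * edist x y := by gcongr
      _ ≤ edist (Φ.comp w n le_rfl x) (Φ.comp w n le_rfl y) :=
          Φ.pow_mul_edist_le hΦ w hle n le_rfl
      -- The Bowen metric includes the final time `k = n`, where all `n` expansions have taken
      -- effect.
      _ ≤ Φ.bowenEDist w x y :=
          le_iSup (fun k : Fin (n + 1) ↦ edist (Φ.comp w k (Nat.le_of_lt_succ k.isLt) x)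
            (Φ.comp w k (Nat.le_of_lt_succ k.isLt) y)) (Fin.last n)
      _ ≤ ENNReal.ofReal ρ := hle
  exact hbound.not_gt ((ENNReal.ofReal_lt_ofReal_iff (by positivity)).2 hgrow)

theorem proposition6
    {E : Type*} [NormedAddCommGroup E] [NormedSpace ℝ E] [FiniteDimensional ℝ E]
    {H : Type*} [TopologicalSpace H] {I : ModelWithCorners ℝ E H}
    {M : Type*} [EMetricSpace M] [CompactSpace M] [ChartedSpace H M] [IsManifold I ∞ M]
    [BoundarylessManifold I M]
    [Bundle.RiemannianBundle (fun x : M ↦ TangentSpace I x)]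
    [IsContMDiffRiemannianBundle I ∞ E (fun x : M ↦ TangentSpace I x)]
    [IsRiemannianManifold I M]
    (Φ : NAIFS M) (σ ρ : ℝ) (hΦ : Φ.IsUniformlyExpanding I σ ρ) :
    Φ.IsStarExpansive ∧ Φ.IsExpansive ρ := by
  obtain ⟨hσ, hρ, hmap⟩ := hΦ
  have hexp : Φ.IsExpansive ρ := by
    refine Φ.isExpansive_of_mul_edist_le hσ fun j i x y hxy ↦ ?_
    obtain ⟨p, hx, hy⟩ := exists_mem_eball_of_edist_le I (ENNReal.ofReal_pos.2 hρ)
      ENNReal.ofReal_ne_top hxy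
    exact (hmap j i).le_edist p x hx y hy
  exact ⟨⟨ρ, hρ, hexp⟩, hexp⟩
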